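/- All groups are finite. A group $G$ is a Camina group if the conjugacy class of $g$ is the coset $gG'$ for every $g \in G \setminus G'$, where $G' = [G,G]$. A finite group is a VZ-group if every irreducible complex character $\chi$ of it with $\chi(1) \neq 1$ vanishes off the center of the group. Let $p$ be a prime and let $G$ be a finite $p$-group that is a Camina group and has nilpotence class $3$. Write $G_3 = [G', G]$ and $C = C_G(G')$, and suppose that $C > G'$. Then: 1. $C' = G_3$ and $Z(C) = G'$; 2. $C$ is a VZ-group; 3. $|G_3| \le |G' : G_3|^{1/2}$. -/

import Mathlib

open scoped Pointwise

/-- A Camina group: the conjugacy class of `g` is the coset `gG'` for every `g ∈ G \ G'`. -/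
def IsCaminaGroup (G : Type*) [Group G] : Prop :=
  ∀ g : G, g ∉ commutator G → conjugatesOf g = g • (commutator G : Set G)

/-- `χ` is an irreducible complex character of `H`: the character of an irreducible
representation on `ℂⁿ` for some `n`. -/
def IsIrreducibleCharacter {H : Type*} [Group H] (χ : H → ℂ) : Prop :=
  ∃ (n : ℕ) (ρ : Representation ℂ H (Fin n → ℂ)), ρ.IsIrreducible ∧ χ = ρ.character

/-- A VZ-group: every nonlinear (that is, of degree `χ 1 ≠ 1`) irreducible complex character
vanishes off the center. -/
def IsVZGroup (H : Type*) [Group H] : Prop :=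
  ∀ χ : H → ℂ, IsIrreducibleCharacter χ → χ 1 ≠ 1 →
    ∀ h : H, h ∉ Subgroup.center H → χ h = 0

/-- The third term `G_3 = [G', G]` of the lower central series. -/
def thirdTerm (G : Type*) [Group G] : Subgroup G :=
  ⁅commutator G, (⊤ : Subgroup G)⁆

/-!
Let `Z = Z(G)` and `C = C_G(G')`. If `G₃` embeds in `ℂˣ`, the commutator pairing `G' × G → G₃`
gives `|G : C| = |G' : Z|`, so `C` is the centralizer of `x` modulo `Z` for every `x ∈ C ∖ G'`.
Hence for `g ∉ C` the centralizer of `g` modulo `Z` meets `C` inside `G'`, and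
`|C : G'| ≤ |G' : Z|`. As `G / G₃` is a VZ-group, `|G' : G₃|² ≤ |G : G'| ≤ |G' : Z|²`, which forces
`Z = G₃`. In general one passes to the quotients of `G` by the kernels of the characters of `G₃`;
these separate the points of `G₃`, so `C` contains the centralizer of `x` modulo `G₃` for every
`x ∈ C ∖ G'`. This makes `(C, G')` a generalized Camina pair with `C' = G₃` and `Z(C) = G'`, that
is, `C` a VZ-group, and again `|C : G'| ≤ |G' : G₃|`.

Both `|G₃|` and `|G' : G₃|` are bounded by the inequality `|H'|² ≤ |H : Z(H)|` for a nonabelian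
VZ-group `H` of prime power order: the commutator is an alternating bilinear map
`H/Z(H) × H/Z(H) → H'` over `𝔽_p` all of whose nonzero slices are surjective, and the determinant
of the corresponding system of alternating matrices is the square of a polynomial of degree half
the size, so the Chevalley–Warning theorem bounds the number of parameters.
-/

section AlternatingMatrices

variable {m n R : Type*} [CommRing R]

/-- Alternating matrices: skew-symmetric with zero diagonal. Skew-symmetry alone would not do
in characteristic two. -/
structure IsAlternatingMatrix (A : Matrix n n R) : Prop where
  diag_eq_zero (i : n) : A i i = 0
  transpose_eq_neg : A.transpose = -A

namespace IsAlternatingMatrix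

variable {A B : Matrix n n R}

theorem apply_swap (hA : IsAlternatingMatrix A) (i j : n) : A j i = -A i j :=
  congrFun₂ hA.transpose_eq_neg i j

theorem add (hA : IsAlternatingMatrix A) (hB : IsAlternatingMatrix B) :
    IsAlternatingMatrix (A + B) where
  diag_eq_zero i := by rw [Matrix.add_apply, hA.diag_eq_zero, hB.diag_eq_zero, add_zero]
  transpose_eq_neg := by
    rw [Matrix.transpose_add, hA.transpose_eq_neg, hB.transpose_eq_neg, neg_add]

theorem transpose (hA : IsAlternatingMatrix A) : IsAlternatingMatrix A.transpose where
  diag_eq_zero := hA.diag_eq_zero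
  transpose_eq_neg := by rw [hA.transpose_eq_neg, Matrix.transpose_neg, hA.transpose_eq_neg]

theorem submatrix (hA : IsAlternatingMatrix A) (f : m → n) :
    IsAlternatingMatrix (A.submatrix f f) where
  diag_eq_zero i := hA.diag_eq_zero (f i)
  transpose_eq_neg := Matrix.ext fun i j => hA.apply_swap (f i) (f j)

theorem map {S : Type*} [CommRing S] (hA : IsAlternatingMatrix A) (f : R →+* S) :
    IsAlternatingMatrix (A.map f) where
  diag_eq_zero i := by rw [Matrix.map_apply, hA.diag_eq_zero, map_zero]
  transpose_eq_neg := Matrix.ext fun i j => by simp [hA.apply_swap i j]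

theorem congruence [Fintype n] (hA : IsAlternatingMatrix A) (P : Matrix m n R) :
    IsAlternatingMatrix (P * A * P.transpose) where
  diag_eq_zero i := by
    classical
    simp only [Matrix.mul_apply, Matrix.transpose_apply, Finset.sum_mul]
    rw [← Finset.sum_product']
    refine Finset.sum_involution (fun x _ => x.swap) (fun x _ => ?_) (fun x _ hx hswap => hx ?_)
      (fun _ _ => Finset.mem_univ _) fun x _ => Prod.swap_swap x
    · rw [Prod.fst_swap, Prod.snd_swap, hA.apply_swap x.1 x.2]
      ring
    · rw [show x.2 = x.1 from congrArg Prod.fst hswap, hA.diag_eq_zero, mul_zero, zero_mul]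
  transpose_eq_neg := by
    rw [Matrix.transpose_mul, Matrix.transpose_mul, Matrix.transpose_transpose,
      hA.transpose_eq_neg, Matrix.neg_mul, Matrix.mul_neg, Matrix.mul_assoc]

variable [Fintype n] [DecidableEq n]

theorem invOf (hA : IsAlternatingMatrix A) [Invertible A] : IsAlternatingMatrix (⅟A) := by
  have h : ⅟A * A * (⅟A).transpose = (⅟A).transpose := by rw [invOf_mul_self, Matrix.one_mul]
  simpa only [h, Matrix.transpose_transpose] using (hA.congruence (⅟A)).transpose

theorem schurComplement {A : Matrix (n ⊕ m) (n ⊕ m) R} (hA : IsAlternatingMatrix A)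
    [Invertible A.toBlocks₁₁] :
    IsAlternatingMatrix (A.toBlocks₂₂ - A.toBlocks₂₁ * ⅟A.toBlocks₁₁ * A.toBlocks₁₂) := by
  have h₁₂ : A.toBlocks₁₂ = -A.toBlocks₂₁.transpose := by
    ext i j
    exact hA.apply_swap (Sum.inr j) (Sum.inl i)
  rw [h₁₂, Matrix.mul_neg, sub_neg_eq_add]
  have h₁₁ : IsAlternatingMatrix A.toBlocks₁₁ := hA.submatrix Sum.inl
  exact (hA.submatrix Sum.inr).add (h₁₁.invOf.congruence _)

theorem det_fin_two {A : Matrix (Fin 2) (Fin 2) R} (hA : IsAlternatingMatrix A) :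
    A.det = A 0 1 * A 0 1 := by
  rw [Matrix.det_fin_two, hA.diag_eq_zero, hA.apply_swap 0 1]
  ring

theorem isSquare_det_of_field {K : Type*} [Field K] {A : Matrix n n K}
    (hA : IsAlternatingMatrix A) : IsSquare A.det := by
  induction hn : Fintype.card n using Nat.strong_induction_on generalizing n with
  | _ d ih =>
  by_cases hzero : A = 0
  · rcases isEmpty_or_nonempty n with _ | hne
    · rw [Matrix.det_isEmpty]
      exact IsSquare.one
    · rw [hzero, Matrix.det_zero]
      exact IsSquare.zero
  obtain ⟨i, j, hij⟩ : ∃ i j, A i j ≠ 0 := by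
    by_contra! h
    exact hzero (Matrix.ext h)
  have hinj : Function.Injective ![i, j] := by
    refine List.nodup_ofFn.mp ?_
    simpa using fun h : i = j => hij (h ▸ hA.diag_eq_zero i)
  let e : Fin 2 ⊕ ↥(Set.range ![i, j])ᶜ ≃ n :=
    ((Equiv.ofInjective _ hinj).sumCongr (Equiv.refl _)).trans (Equiv.Set.sumCompl _)
  have hM := hA.submatrix e
  set M := A.submatrix e e
  have hpivot : M.toBlocks₁₁.det = A i j * A i j := (hM.submatrix Sum.inl).det_fin_two
  have : Invertible M.toBlocks₁₁ :=
    M.toBlocks₁₁.invertibleOfIsUnitDet (hpivot ▸ (mul_ne_zero hij hij).isUnit)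
  rw [← Matrix.det_submatrix_equiv_self e, ← Matrix.fromBlocks_toBlocks (A.submatrix e e),
    Matrix.det_fromBlocks₁₁, hpivot]
  refine (IsSquare.mul_self _).mul (ih _ ?_ hM.schurComplement rfl)
  rw [← hn, ← Fintype.card_congr e, Fintype.card_sum, Fintype.card_fin]
  exact Nat.lt_add_of_pos_left two_pos

theorem isSquare_det [IsDomain R] [IsIntegrallyClosed R] (hA : IsAlternatingMatrix A) :
    IsSquare A.det := by
  obtain ⟨f, hf⟩ := (hA.map (algebraMap R (FractionRing R))).isSquare_det_of_field
  rw [← RingHom.mapMatrix_apply, ← RingHom.map_det, ← sq] at hf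
  obtain ⟨r, rfl⟩ := IsIntegrallyClosed.exists_algebraMap_eq_of_isIntegral_pow (R := R) two_pos
    (hf ▸ isIntegral_algebraMap)
  refine ⟨r, FaithfulSMul.algebraMap_injective R (FractionRing R) ?_⟩
  rw [hf, map_mul, sq]

end IsAlternatingMatrix

end AlternatingMatrices

section AlternatingPairings

variable {n K : Type*} [Fintype n] [DecidableEq n]

theorem totalDegree_det_le {σ R : Type*} [CommRing R] {M : Matrix n n (MvPolynomial σ R)} {k : ℕ}
    (hM : ∀ i j, (M i j).totalDegree ≤ k) : M.det.totalDegree ≤ Fintype.card n * k := by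
  rw [Matrix.det_apply]
  refine MvPolynomial.totalDegree_finsetSum_le fun σ _ => ?_
  calc _ ≤ (∏ i, M (σ i) i).totalDegree := MvPolynomial.totalDegree_smul_le _ _
    _ ≤ ∑ i, (M (σ i) i).totalDegree := MvPolynomial.totalDegree_finsetProd _ _
    _ ≤ ∑ _i : n, k := Finset.sum_le_sum fun i _ => hM _ _
    _ = Fintype.card n * k := by rw [Finset.sum_const, Finset.card_univ, smul_eq_mul]

variable [Field K]

theorem isAlternatingMatrix_toMatrix₂ {V : Type*} [AddCommGroup V] [Module K V]
    {B : V →ₗ[K] V →ₗ[K] K} (hB : B.IsAlt) (b : Module.Basis n K V) :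
    IsAlternatingMatrix (LinearMap.toMatrix₂ b b B) where
  diag_eq_zero i := by rw [LinearMap.toMatrix₂_apply, hB.self_eq_zero]
  transpose_eq_neg := by ext i j; simp [← hB.neg (b i) (b j)]

theorem exists_sq_eval_eq_det_sum_smul {ι : Type*} [Fintype ι] {A : ι → Matrix n n K}
    (hA : ∀ k, IsAlternatingMatrix (A k)) :
    ∃ f : MvPolynomial ι K, 2 * f.totalDegree ≤ Fintype.card n ∧
      ∀ x, MvPolynomial.eval x f ^ 2 = (∑ k, x k • A k).det := by
  let M : Matrix n n (MvPolynomial ι K) :=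
    Matrix.of fun i j => ∑ k, MvPolynomial.X k * MvPolynomial.C (A k i j)
  have hM_apply (i j) : M i j = ∑ k, MvPolynomial.X k * MvPolynomial.C (A k i j) := rfl
  have hM : IsAlternatingMatrix M :=
    { diag_eq_zero i := by simp [hM_apply, (hA _).diag_eq_zero]
      transpose_eq_neg := by ext1 i j; simp [hM_apply, (hA _).apply_swap i j] }
  have hMdeg : M.det.totalDegree ≤ Fintype.card n * 1 := totalDegree_det_le fun i j => by
    rw [hM_apply]
    refine MvPolynomial.totalDegree_finsetSum_le fun k _ => ?_
    exact (MvPolynomial.totalDegree_mul _ _).trans (by simp)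
  obtain ⟨f, hf⟩ := hM.isSquare_det
  refine ⟨f, ?_, fun x => ?_⟩
  · rcases eq_or_ne f 0 with rfl | hf0
    · simp
    · rwa [hf, MvPolynomial.totalDegree_mul_of_isDomain hf0 hf0, ← two_mul, mul_one] at hMdeg
  · rw [sq, ← map_mul, ← hf, RingHom.map_det]
    congr 1
    ext i j
    simp [hM_apply, Matrix.sum_apply]

variable [Finite K]

/-- By Chevalley–Warning, the square root of the determinant of the generic member of the system,
which has degree at most half the size, would have a nontrivial zero if there were more
parameters than that. -/
theorem two_mul_finrank_le_card_of_det_ne_zero {U : Type*} [AddCommGroup U] [Module K U]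
    [FiniteDimensional K U] [Nonempty n] (L : U →ₗ[K] Matrix n n K)
    (halt : ∀ u, IsAlternatingMatrix (L u)) (hdet : ∀ u ≠ 0, (L u).det ≠ 0) :
    2 * Module.finrank K U ≤ Fintype.card n := by
  classical
  have := Fintype.ofFinite K
  let b := Module.finBasis K U
  obtain ⟨f, hf_deg, hf_eval⟩ := exists_sq_eval_eq_det_sum_smul fun k => halt (b k)
  have hf_zero (x) : MvPolynomial.eval x f = 0 ↔ x = 0 := by
    have hL : ∑ k, x k • L (b k) = L (b.equivFun.symm x) := by
      simp only [Module.Basis.equivFun_symm_apply, map_sum, map_smul]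
    rw [← sq_eq_zero_iff, hf_eval, hL]
    constructor
    · contrapose!
      exact fun hx => hdet _ (b.equivFun.symm.map_ne_zero_iff.mpr hx)
    · rintro rfl
      rw [map_zero, map_zero, Matrix.det_zero]
  by_contra! hlt
  have hdeg : f.totalDegree < Fintype.card (Fin (Module.finrank K U)) := by
    rw [Fintype.card_fin]
    omega
  have hdvd := char_dvd_card_solutions (ringChar K) hdeg
  simp only [hf_zero, Fintype.card_unique] at hdvd
  exact CharP.ringChar_ne_one (Nat.dvd_one.mp hdvd)

theorem two_mul_finrank_le_finrank_of_isAlt {V W : Type*} [AddCommGroup V] [Module K V]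
    [FiniteDimensional K V] [Nontrivial V] [AddCommGroup W] [Module K W] [FiniteDimensional K W]
    {β : V →ₗ[K] V →ₗ[K] W} (halt : β.IsAlt) (hsurj : ∀ v ≠ 0, Function.Surjective (β v)) :
    2 * Module.finrank K W ≤ Module.finrank K V := by
  let b := Module.finBasis K V
  have : Nonempty (Fin (Module.finrank K V)) := Fin.pos_iff_nonempty.mp Module.finrank_pos
  let L : Module.Dual K W →ₗ[K] Matrix _ _ K :=
    { toFun l := LinearMap.toMatrix₂ b b (β.compr₂ l)
      map_add' l l' := by ext; simp
      map_smul' c l := by ext; simp }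
  rw [← Subspace.dual_finrank_eq, ← Fintype.card_fin (Module.finrank K V)]
  refine two_mul_finrank_le_card_of_det_ne_zero L (fun l => ?_) fun l hl => ?_
  · exact isAlternatingMatrix_toMatrix₂ (fun v => by simp [halt.self_eq_zero]) b
  · refine (LinearMap.separatingLeft_iff_det_ne_zero b).mp fun v hv => by_contra fun hv0 => hl ?_
    ext w
    obtain ⟨y, rfl⟩ := hsurj v hv0 w
    exact hv y

theorem card_sq_le_card_of_isAlt {V W : Type*} [AddCommGroup V] [Module K V] [Finite V]
    [Nontrivial V] [AddCommGroup W] [Module K W] [Finite W] {β : V →ₗ[K] V →ₗ[K] W}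
    (halt : β.IsAlt) (hsurj : ∀ v ≠ 0, Function.Surjective (β v)) :
    Nat.card W ^ 2 ≤ Nat.card V := by
  rw [Module.natCard_eq_pow_finrank (K := K) (V := W),
    Module.natCard_eq_pow_finrank (K := K) (V := V), ← pow_mul, mul_comm]
  exact Nat.pow_le_pow_right Nat.card_pos (two_mul_finrank_le_finrank_of_isAlt halt hsurj)

end AlternatingPairings

section AlternatingHoms

variable {p : ℕ} [Fact p.Prime] {W : Type*} [CommGroup W] [Finite W]

theorem not_surjective_pow_of_isPGroup [Nontrivial W] (hW : IsPGroup p W) :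
    ¬ Function.Surjective fun w : W => w ^ p := by
  intro hsurj
  have hdvd : p ∣ Nat.card W := hW.card_eq_or_dvd.resolve_left Finite.one_lt_card.ne'
  obtain ⟨w, hw⟩ := exists_prime_orderOf_dvd_card' p hdvd
  have hw1 : w = 1 := Finite.injective_iff_surjective.mpr hsurj <| by
    simp only [one_pow, ← hw, pow_orderOf_eq_one]
  exact (Fact.out : p.Prime).one_lt.ne (by rw [← hw, hw1, orderOf_one])

theorem card_sq_le_card_of_alternating_of_zmod_module {V W : Type*} [AddCommGroup V]
    [Module (ZMod p) V] [Finite V] [Nontrivial V] [AddCommGroup W] [Module (ZMod p) W] [Finite W]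
    (β : V →+ V →+ W) (halt : ∀ v, β v v = 0) (hsurj : ∀ v ≠ 0, Function.Surjective (β v)) :
    Nat.card W ^ 2 ≤ Nat.card V :=
  card_sq_le_card_of_isAlt (K := ZMod p)
    (β := AddMonoidHom.toZModLinearMap p
      ((AddMonoidHom.toZModLinearMapEquiv p).toAddMonoidHom.comp β)) halt hsurj

variable {Q : Type*} [CommGroup Q] [Finite Q] [Nontrivial Q]

theorem card_sq_le_card_of_alternating (hW : IsPGroup p W) (γ : Q →* Q →* W)
    (halt : ∀ x, γ x x = 1) (hsurj : ∀ x ≠ 1, Function.Surjective (γ x)) :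
    Nat.card W ^ 2 ≤ Nat.card Q := by
  rcases subsingleton_or_nontrivial W with _ | _
  · rw [Nat.card_unique, one_pow]
    exact Nat.card_pos
  have hQ_pow (x : Q) : x ^ p = 1 := by
    by_contra hx
    refine not_surjective_pow_of_isPGroup hW fun w => ?_
    obtain ⟨y, rfl⟩ := hsurj _ hx w
    exact ⟨γ x y, by rw [map_pow, MonoidHom.pow_apply]⟩
  have hW_pow (w : W) : w ^ p = 1 := by
    obtain ⟨x, hx⟩ := exists_ne (1 : Q)
    obtain ⟨y, rfl⟩ := hsurj x hx w
    rw [← MonoidHom.pow_apply, ← map_pow, hQ_pow, map_one, MonoidHom.one_apply]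
  let _ : Module (ZMod p) (Additive Q) := AddCommGroup.zmodModule hQ_pow
  let _ : Module (ZMod p) (Additive W) := AddCommGroup.zmodModule hW_pow
  let β : Additive Q →+ Additive Q →+ Additive W :=
    AddMonoidHom.mk' (fun x => MonoidHom.toAdditive (γ x.toMul)) fun x x' =>
      AddMonoidHom.ext fun y => DFunLike.congr_fun (map_mul γ x.toMul x'.toMul) y.toMul
  simpa only [Nat.card_congr Additive.toMul] using
    card_sq_le_card_of_alternating_of_zmod_module (p := p) β halt hsurj

theorem card_sq_le_index_ker_of_alternating {H : Type*} [Group H] [Finite H] (hW : IsPGroup p W)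
    {β : H →* H →* W} (hβ : β ≠ 1) (halt : ∀ x, β x x = 1)
    (hsurj : ∀ x ∉ β.ker, Function.Surjective (β x)) : Nat.card W ^ 2 ≤ β.ker.index := by
  have hskew (x y : H) : β x y * β y x = 1 := by
    simpa only [map_mul, MonoidHom.mul_apply, halt, one_mul, mul_one, mul_comm] using halt (x * y)
  have : Finite β.range := Finite.of_surjective _ β.rangeRestrict_surjective
  have : Nontrivial β.range := by
    rwa [β.range.nontrivial_iff_ne_bot, Ne, MonoidHom.range_eq_bot_iff]
  have hker : β.rangeRestrict.ker ≤ β.range.subtype.flip.ker := by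
    rintro y hy
    ext ⟨_, x, rfl⟩
    have hy : β y = 1 := congrArg Subtype.val hy
    simpa [hy] using hskew x y
  let γ : β.range →* β.range →* W :=
    (β.rangeRestrict.liftOfSurjective β.rangeRestrict_surjective ⟨β.range.subtype.flip, hker⟩).flip
  have hγ (x y : H) : γ (β.rangeRestrict x) (β.rangeRestrict y) = β x y :=
    DFunLike.congr_fun (MonoidHom.liftOfRightInverse_comp_apply β.rangeRestrict _
      (Function.rightInverse_surjInv β.rangeRestrict_surjective)
      ⟨β.range.subtype.flip, hker⟩ y) (β.rangeRestrict x)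
  rw [Subgroup.index_ker]
  refine card_sq_le_card_of_alternating hW γ (fun q => ?_) fun q hq w => ?_
  · obtain ⟨x, rfl⟩ := β.rangeRestrict_surjective q
    rw [hγ, halt]
  · obtain ⟨x, rfl⟩ := β.rangeRestrict_surjective q
    obtain ⟨y, rfl⟩ := hsurj x (fun hx => hq (Subtype.ext hx)) w
    exact ⟨β.rangeRestrict y, hγ x y⟩

end AlternatingHoms

section Duality

variable {A B k : Type*} [Group A] [Group B] [Finite B]
  [Field k] [IsAlgClosed k] [CharZero k]

theorem index_ker_le_index_ker_flip (γ : A →* B →* kˣ) : γ.ker.index ≤ γ.flip.ker.index := by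
  have : Finite γ.flip.range := Finite.of_surjective _ γ.flip.rangeRestrict_surjective
  have hcard : Nat.card (γ.flip.range →* kˣ) = Nat.card γ.flip.range :=
    CommGroup.card_monoidHom_of_hasEnoughRootsOfUnity _ k
  have : Finite (γ.flip.range →* kˣ) := Nat.finite_of_card_ne_zero (hcard ▸ Nat.card_pos.ne')
  have hker : γ.flip.range.subtype.flip.ker = γ.ker := by
    ext a
    simp only [MonoidHom.mem_ker]
    refine ⟨fun h => ?_, fun h => ?_⟩
    · ext b : 1
      exact DFunLike.congr_fun h (γ.flip.rangeRestrict b)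
    · ext ⟨_, b, rfl⟩ : 1
      exact DFunLike.congr_fun h b
  rw [← hker, Subgroup.index_ker, Subgroup.index_ker, ← hcard]
  exact Subgroup.card_le_card_group _

theorem index_ker_eq_index_ker_flip [Finite A] (γ : A →* B →* kˣ) :
    γ.ker.index = γ.flip.ker.index :=
  (index_ker_le_index_ker_flip γ).antisymm (index_ker_le_index_ker_flip γ.flip)

end Duality

section CommutatorPairing

open scoped commutatorElement IsMulCommutative

variable {G : Type*} [Group G]

theorem isMulCommutative_of_le_center {W : Subgroup G} (hW : W ≤ Subgroup.center G) :
    IsMulCommutative W :=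
  ⟨⟨fun a b => Subtype.ext (Subgroup.mem_center_iff.mp (hW b.2) a)⟩⟩

/-- The commutator map `(a, g) ↦ ⁅a, g⁆` from `A × G` to a central subgroup `W` containing
`⁅A, G⁆`, as a bihomomorphism. -/
def commutatorPairing {A W : Subgroup G} [IsMulCommutative W] (hAW : ⁅A, ⊤⁆ ≤ W)
    (hW : W ≤ Subgroup.center G) : A →* G →* W :=
  have hmem (a : A) (g : G) : ⁅(a : G), g⁆ ∈ W :=
    hAW (Subgroup.commutator_mem_commutator a.2 trivial)
  have hcomm (a : A) (g x : G) : x * ⁅(a : G), g⁆ = ⁅(a : G), g⁆ * x :=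
    Subgroup.mem_center_iff.mp (hW (hmem a g)) x
  MonoidHom.mk'
    (fun a : A => MonoidHom.mk' (fun g => (⟨⁅(a : G), g⁆, hmem a g⟩ : W)) fun g h =>
      Subtype.ext <| by
      change ⁅(a : G), g * h⁆ = ⁅(a : G), g⁆ * ⁅(a : G), h⁆
      rw [commutatorElement_mul_right_eq_mul_conj, mul_assoc _ g, hcomm, ← mul_assoc,
        mul_inv_cancel_right])
    fun a b => MonoidHom.ext fun g => Subtype.ext <| by
      change ⁅(a * b : G), g⁆ = ⁅(a : G), g⁆ * ⁅(b : G), g⁆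
      rw [commutatorElement_mul_left_eq_conj_mul, hcomm b g a, mul_inv_cancel_right, hcomm]

end CommutatorPairing

section IrreducibleRepresentations

open scoped commutatorElement

variable {k G V : Type*} [Field k] [AddCommGroup V] [Module k V]

theorem isIrreducible_of_isIrreducible_comp {H : Type*} [Monoid H] [Monoid G] (f : H →* G)
    (σ : Representation k G V) (h : Representation.IsIrreducible (σ.comp f)) :
    σ.IsIrreducible where
  exists_pair_ne :=
    ⟨⊥, ⊤, fun hσ => bot_ne_top (α := Subrepresentation (σ.comp f)) <|
      Subrepresentation.toSubmodule_injective <|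
        show (⊥ : Submodule k V) = ⊤ from congrArg (·.toSubmodule) hσ⟩
  eq_bot_or_eq_top S := by
    let T : Subrepresentation (σ.comp f) :=
      ⟨S.toSubmodule, fun x => S.apply_mem_toSubmodule (f x)⟩
    exact (h.eq_bot_or_eq_top T).imp
      (fun hT => Subrepresentation.toSubmodule_injective (congrArg (·.toSubmodule) hT))
      fun hT => Subrepresentation.toSubmodule_injective (congrArg (·.toSubmodule) hT)

variable [FiniteDimensional k V] [IsAlgClosed k] [Group G] {ρ : Representation k G V}
  (hρ : ρ.IsIrreducible)

include hρ

theorem finrank_eq_one_of_forall_commute (hcomm : ∀ x y, Commute (ρ x) (ρ y)) :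
    Module.finrank k V = 1 := by
  let σ : Representation k (MonoidHom.mrange ρ) V := (MonoidHom.mrange ρ).subtype
  have : σ.IsIrreducible := isIrreducible_of_isIrreducible_comp ρ.mrangeRestrict σ hρ
  have : IsMulCommutative (MonoidHom.mrange ρ) := ⟨⟨by
    rintro ⟨_, x, rfl⟩ ⟨_, y, rfl⟩
    exact Subtype.ext (hcomm x y)⟩⟩
  exact Representation.IsIrreducible.finrank_eq_one_of_isMulCommutative σ

theorem finrank_eq_one_of_commutator_le_ker (hker : commutator G ≤ ρ.ker) :
    Module.finrank k V = 1 := by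
  refine finrank_eq_one_of_forall_commute hρ fun x y => ?_
  have hxy : ρ ⁅x, y⁆ = 1 := hker (Subgroup.commutator_mem_commutator trivial trivial)
  have hswap : ρ (x * y) = ρ (y * x) := by
    rw [← one_mul (ρ (y * x)), ← hxy, ← map_mul, commutatorElement_def]
    group
  rwa [map_mul, map_mul] at hswap

theorem exists_apply_eq_smul_one_of_mem_center {z : G} (hz : z ∈ Subgroup.center G) :
    ∃ c : k, ρ z = c • 1 := by
  let f : Representation.IntertwiningMap ρ ρ := ⟨ρ z, fun y => by
    change ρ z * ρ y = ρ y * ρ z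
    rw [← map_mul, ← map_mul, Subgroup.mem_center_iff.mp hz y]⟩
  obtain ⟨c, hc⟩ :=
    (Representation.IsIrreducible.algebraMap_intertwiningMap_bijective_of_isAlgClosed
      (ρ := ρ)).2 f
  exact ⟨c, LinearMap.ext fun v => (DFunLike.congr_fun hc v).symm⟩

theorem character_eq_zero_of_isConj_mul {z x : G} (hz : z ∈ Subgroup.center G) (hρz : ρ z ≠ 1)
    (hx : IsConj x (z * x)) : ρ.character x = 0 := by
  obtain ⟨c, hc⟩ := exists_apply_eq_smul_one_of_mem_center hρ hz
  obtain ⟨y, hy⟩ := isConj_iff.mp hx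
  have hchar : c * ρ.character x = ρ.character x :=
    calc c * ρ.character x = ρ.character (z * x) := by
          simp only [Representation.character, map_mul, hc, smul_mul_assoc, one_mul, map_smul,
            smul_eq_mul]
      _ = ρ.character x := by rw [← hy, ρ.char_conj]
  by_contra hne
  exact hρz (by rw [hc, mul_eq_right₀ hne |>.mp hchar, one_smul])

end IrreducibleRepresentations

section GeneralizedCaminaPairs

open scoped commutatorElement IsMulCommutative

variable {G : Type*} [Group G]

theorem index_centralizer_singleton (g : G) :
    (Subgroup.centralizer {g}).index = (conjugatesOf g).ncard := by
  rw [Subgroup.centralizer_eq_comap_stabilizer]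
  calc _ = (MulAction.stabilizer (ConjAct G) g).index :=
        Subgroup.index_comap_of_surjective _ ConjAct.toConjAct.surjective
    _ = (MulAction.orbit (ConjAct G) g).ncard := MulAction.index_stabilizer _ g
    _ = (conjugatesOf g).ncard := congrArg Set.ncard (ConjAct.orbit_eq_carrier_conjClasses g)

theorem map_commutator_of_surjective {G' : Type*} [Group G'] {f : G →* G'}
    (hf : Function.Surjective f) : (commutator G).map f = commutator G' := by
  rw [map_commutator_eq, MonoidHom.range_eq_top.mpr hf, commutator_def]

/-- `(G, N)` is a generalized Camina pair: the conjugacy class of `g` is the coset `gG'` for every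
`g ∉ N`. The Camina groups are the case `N = G'`. -/
def IsGeneralizedCaminaPair (N : Subgroup G) : Prop :=
  ∀ g ∉ N, conjugatesOf g = g • (commutator G : Set G)

theorem isGeneralizedCaminaPair_iff {N : Subgroup G} :
    IsGeneralizedCaminaPair N ↔ ∀ g ∉ N, ∀ z ∈ commutator G, ∃ y, ⁅g, y⁆ = z := by
  refine forall₂_congr fun g _ => ?_
  have hcoset (b : G) : b ∈ g • (commutator G : Set G) ↔ b * g⁻¹ ∈ commutator G := by
    rw [Set.mem_smul_set_iff_inv_smul_mem, smul_eq_mul, SetLike.mem_coe,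
      (inferInstance : (commutator G).Normal).mem_comm_iff]
  have hclass (b : G) : b ∈ conjugatesOf g ↔ ∃ y, ⁅g, y⁆ = (b * g⁻¹)⁻¹ :=
    isConj_iff.trans <| exists_congr fun y => by
      rw [← commutatorElement_inv, inv_inj, commutatorElement_def, mul_left_inj]
  simp only [Set.ext_iff, hcoset, hclass]
  refine ⟨fun hg z hz => ?_, fun hg b => ⟨?_, fun hb => hg _ (inv_mem hb)⟩⟩
  · simpa only [mul_inv_cancel_right, inv_inv, inv_mem_iff, hz, iff_true] using hg (z⁻¹ * g)
  · rintro ⟨y, hy⟩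
    rw [← inv_mem_iff, ← hy]
    exact Subgroup.commutator_mem_commutator trivial trivial

namespace IsGeneralizedCaminaPair

variable {N : Subgroup G} (h : IsGeneralizedCaminaPair N)

include h

theorem center_le (hne : commutator G ≠ ⊥) : Subgroup.center G ≤ N := by
  intro g hg
  by_contra hgN
  obtain ⟨z, hz⟩ := Subgroup.ne_bot_iff_exists_ne_one.mp hne
  obtain ⟨y, hy⟩ := isGeneralizedCaminaPair_iff.mp h g hgN z z.2
  refine hz (Subtype.ext ?_)
  rw [← hy, Subgroup.coe_one, commutatorElement_eq_one_iff_mul_comm]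
  exact (Subgroup.mem_center_iff.mp hg y).symm

theorem commutator_le : commutator G ≤ N := by
  intro z hz
  by_contra hzN
  obtain ⟨y, hy⟩ := isGeneralizedCaminaPair_iff.mp h z hzN z hz
  have hz1 : z = 1 := by
    rwa [commutatorElement_def, mul_assoc, mul_assoc, mul_eq_left, ← mul_assoc,
      conj_eq_one_iff, inv_eq_one] at hy
  exact hzN (hz1 ▸ N.one_mem)

theorem map {G' : Type*} [Group G'] {f : G →* G'} (hf : Function.Surjective f) :
    IsGeneralizedCaminaPair (N.map f) := by
  refine isGeneralizedCaminaPair_iff.mpr fun q hq w hw => ?_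
  obtain ⟨g, rfl⟩ := hf q
  rw [← map_commutator_of_surjective hf] at hw
  obtain ⟨z, hz, rfl⟩ := hw
  obtain ⟨y, rfl⟩ := isGeneralizedCaminaPair_iff.mp h g (mt (Subgroup.mem_map_of_mem f) hq) z hz
  exact ⟨f y, (map_commutatorElement f g y).symm⟩

theorem index_centralizer_singleton_eq {g : G} (hg : g ∉ N) :
    (Subgroup.centralizer {g}).index = Nat.card (commutator G) := by
  rw [index_centralizer_singleton, h g hg, Set.ncard_smul_set]
  rfl

end IsGeneralizedCaminaPair

theorem isVZGroup_of_isGeneralizedCaminaPair_center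
    (h : IsGeneralizedCaminaPair (Subgroup.center G)) : IsVZGroup G := by
  rintro χ ⟨n, ρ, hρ, rfl⟩ hχ x hx
  obtain ⟨z, hz, hρz⟩ : ∃ z ∈ commutator G, ρ z ≠ 1 := by
    by_contra! hker
    exact hχ (by rw [Representation.char_one, finrank_eq_one_of_commutator_le_ker hρ hker,
      Nat.cast_one])
  have hzc := h.commutator_le hz
  refine character_eq_zero_of_isConj_mul hρ hzc hρz ?_
  rw [← Subgroup.mem_center_iff.mp hzc x]
  exact (h x hx).ge (Set.smul_mem_smul_set hz)

theorem card_commutator_sq_le_index_center [Finite G] {p : ℕ} [Fact p.Prime] (hG : IsPGroup p G)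
    (hne : commutator G ≠ ⊥) (h : IsGeneralizedCaminaPair (Subgroup.center G)) :
    Nat.card (commutator G) ^ 2 ≤ (Subgroup.center G).index := by
  have : IsMulCommutative (commutator G) := isMulCommutative_of_le_center h.commutator_le
  let β : G →* G →* commutator G :=
    (commutatorPairing (A := ⊤) (commutator_def G).ge h.commutator_le).comp
      Subgroup.topEquiv.symm.toMonoidHom
  have hβ (x y : G) : (β x y : G) = ⁅x, y⁆ := rfl
  have hker : β.ker = Subgroup.center G := by
    ext x
    simp only [MonoidHom.mem_ker, MonoidHom.ext_iff, Subtype.ext_iff, hβ, MonoidHom.one_apply,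
      Subgroup.coe_one, commutatorElement_eq_one_iff_mul_comm, Subgroup.mem_center_iff, eq_comm]
  have hβ1 : β ≠ 1 := by
    rwa [Ne, ← MonoidHom.ker_eq_top_iff, hker, ← commutator_eq_bot_iff_center_eq_top]
  rw [← hker]
  refine card_sq_le_index_ker_of_alternating (hG.to_subgroup _) hβ1
    (fun x => Subtype.ext (commutatorElement_self x)) fun x hx z => ?_
  obtain ⟨y, hy⟩ := isGeneralizedCaminaPair_iff.mp h x (hker ▸ hx) z z.2
  exact ⟨y, Subtype.ext hy⟩

end GeneralizedCaminaPairs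

section CentralizerModulo

open scoped commutatorElement

variable {G : Type*} [Group G]

/-- The subgroup of the elements commuting with `x` modulo the normal subgroup `N`. -/
def centralizerModulo (N : Subgroup G) [N.Normal] (x : G) : Subgroup G :=
  (Subgroup.centralizer {(x : G ⧸ N)}).comap (QuotientGroup.mk' N)

theorem mem_centralizerModulo {N : Subgroup G} [N.Normal] {x g : G} :
    g ∈ centralizerModulo N x ↔ ⁅x, g⁆ ∈ N := by
  rw [centralizerModulo, Subgroup.mem_comap, Subgroup.mem_centralizer_singleton_iff,
    ← QuotientGroup.eq_one_iff, QuotientGroup.mk'_apply, eq_comm,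
    ← commutatorElement_eq_one_iff_mul_comm]
  rfl

theorem mem_centralizerModulo_comm {N : Subgroup G} [N.Normal] {x g : G} :
    g ∈ centralizerModulo N x ↔ x ∈ centralizerModulo N g := by
  rw [mem_centralizerModulo, mem_centralizerModulo, ← inv_mem_iff, commutatorElement_inv]

theorem card_commutator_quotient (N : Subgroup G) [N.Normal] :
    Nat.card (commutator (G ⧸ N)) = N.relIndex (commutator G) := by
  rw [← map_commutator_of_surjective (QuotientGroup.mk'_surjective N), ← Subgroup.relIndex_ker,
    QuotientGroup.ker_mk']

theorem IsGeneralizedCaminaPair.index_centralizerModulo {M N : Subgroup G} [N.Normal]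
    (h : IsGeneralizedCaminaPair M) (hNM : N ≤ M) {x : G} (hx : x ∉ M) :
    (centralizerModulo N x).index = N.relIndex (commutator G) := by
  have hx' : (x : G ⧸ N) ∉ M.map (QuotientGroup.mk' N) := fun hmem => hx <| by
    rwa [← QuotientGroup.mk'_apply, ← Subgroup.mem_comap, QuotientGroup.comap_map_mk',
      sup_eq_right.mpr hNM] at hmem
  rw [centralizerModulo, Subgroup.index_comap_of_surjective _ (QuotientGroup.mk'_surjective N),
    (h.map (QuotientGroup.mk'_surjective N)).index_centralizer_singleton_eq hx',
    card_commutator_quotient]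

end CentralizerModulo

section CaminaGroups

open scoped commutatorElement IsMulCommutative

variable {G : Type*} [Group G]

instance thirdTerm_normal : (thirdTerm G).Normal :=
  inferInstanceAs (⁅commutator G, (⊤ : Subgroup G)⁆).Normal

theorem thirdTerm_le_commutator : thirdTerm G ≤ commutator G :=
  Subgroup.commutator_mono le_top le_rfl

theorem commutator_le_center_iff_thirdTerm_eq_bot :
    commutator G ≤ Subgroup.center G ↔ thirdTerm G = ⊥ :=
  Subgroup.commutator_top_right_eq_bot_iff_le_center.symm

theorem map_thirdTerm_of_surjective {G' : Type*} [Group G'] {f : G →* G'}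
    (hf : Function.Surjective f) : (thirdTerm G).map f = thirdTerm G' := by
  rw [thirdTerm, Subgroup.map_commutator, map_commutator_of_surjective hf,
    Subgroup.map_top_of_surjective f hf, thirdTerm]

variable (G) in
/-- The centralizer `C_G(G')` of the commutator subgroup. -/
abbrev commutatorCentralizer : Subgroup G :=
  Subgroup.centralizer (commutator G : Set G)

theorem commutator_le_commutatorCentralizer (h₃ : thirdTerm G ≤ Subgroup.center G) :
    commutator G ≤ commutatorCentralizer G := by
  have : IsMulCommutative (thirdTerm G) := isMulCommutative_of_le_center h₃
  intro z hz
  refine Subgroup.mem_centralizer_iff.mpr fun w hw => ?_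
  have hker := Abelianization.commutator_subset_ker
    (commutatorPairing (A := commutator G) (W := thirdTerm G) le_rfl h₃ ⟨w, hw⟩) hz
  exact commutatorElement_eq_one_iff_mul_comm.mp (congrArg Subtype.val hker)

theorem commutatorCentralizer_ne_top (hne : thirdTerm G ≠ ⊥) :
    commutatorCentralizer G ≠ ⊤ :=
  mt (fun h => commutator_le_center_iff_thirdTerm_eq_bot.mp
    (Subgroup.centralizer_eq_top_iff_subset.mp h)) hne

theorem commutator_ne_bot_of_thirdTerm_ne_bot (hne : thirdTerm G ≠ ⊥) : commutator G ≠ ⊥ :=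
  ne_bot_of_le_ne_bot hne thirdTerm_le_commutator

theorem index_commutatorCentralizer [Finite G] (h₃ : thirdTerm G ≤ Subgroup.center G)
    {φ : thirdTerm G →* ℂˣ} (hφ : Function.Injective φ) :
    (commutatorCentralizer G).index =
      (Subgroup.center G).relIndex (commutator G) := by
  have : IsMulCommutative (thirdTerm G) := isMulCommutative_of_le_center h₃
  let γ : commutator G →* G →* ℂˣ :=
    (commutatorPairing (A := commutator G) (W := thirdTerm G) le_rfl h₃).compr₂ φ
  have hγ (z : commutator G) (g : G) : γ z g = 1 ↔ g * (z : G) = z * g := by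
    rw [eq_comm (a := g * _), ← commutatorElement_eq_one_iff_mul_comm]
    change φ _ = 1 ↔ _
    rw [map_eq_one_iff φ hφ, Subtype.ext_iff]
    rfl
  have hker : γ.ker = (Subgroup.center G).subgroupOf (commutator G) := by
    ext z
    simp only [MonoidHom.mem_ker, MonoidHom.ext_iff, MonoidHom.one_apply, hγ,
      Subgroup.mem_subgroupOf, Subgroup.mem_center_iff]
  have hkerflip : γ.flip.ker = commutatorCentralizer G := by
    ext g
    simp only [MonoidHom.mem_ker, MonoidHom.ext_iff, Subtype.forall, Subgroup.mem_centralizer_iff]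
    exact forall₂_congr fun z hz => (hγ ⟨z, hz⟩ g).trans eq_comm
  rw [← hkerflip, ← index_ker_eq_index_ker_flip, hker, Subgroup.relIndex]

namespace IsCaminaGroup

variable (h : IsCaminaGroup G)

include h

theorem isGeneralizedCaminaPair : IsGeneralizedCaminaPair (commutator G) :=
  h

theorem map {G' : Type*} [Group G'] {f : G →* G'} (hf : Function.Surjective f) :
    IsCaminaGroup G' := by
  have hmap := h.isGeneralizedCaminaPair.map hf
  rwa [map_commutator_of_surjective hf] at hmap

variable [Finite G]

theorem relIndex_commutator_le {D Z : Subgroup G} [Z.Normal] (hZ : Z ≤ commutator G)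
    (hD : commutator G ≤ D) (hDtop : D ≠ ⊤)
    (hDZ : ∀ x ∈ D, x ∉ commutator G → centralizerModulo Z x ≤ D) :
    (commutator G).relIndex D ≤ Z.relIndex (commutator G) := by
  obtain ⟨g, hg⟩ := SetLike.exists_not_mem_of_ne_top D hDtop
  have hle : D ⊓ centralizerModulo Z g ≤ commutator G := by
    rintro x ⟨hxD, hxg⟩
    by_contra hx
    exact hg (hDZ x hxD hx (mem_centralizerModulo_comm.mp hxg))
  calc (commutator G).relIndex D ≤ (D ⊓ centralizerModulo Z g).relIndex D :=
        Subgroup.relIndex_le_of_le_left hle Subgroup.index_ne_zero_of_finite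
    _ = (centralizerModulo Z g).relIndex D := Subgroup.inf_relIndex_left _ _
    _ ≤ (centralizerModulo Z g).index :=
        (Subgroup.relIndex_le_of_le_right le_top Subgroup.index_ne_zero_of_finite).trans_eq
          (Subgroup.relIndex_top_right _)
    _ = Z.relIndex (commutator G) :=
        h.isGeneralizedCaminaPair.index_centralizerModulo hZ fun hgG => hg (hD hgG)

theorem centralizerModulo_center_eq (h₃ : thirdTerm G ≤ Subgroup.center G)
    (hne : thirdTerm G ≠ ⊥) {φ : thirdTerm G →* ℂˣ} (hφ : Function.Injective φ) {x : G}
    (hxD : x ∈ commutatorCentralizer G) (hx : x ∉ commutator G) :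
    centralizerModulo (Subgroup.center G) x = commutatorCentralizer G := by
  have hle : commutatorCentralizer G ≤
      centralizerModulo (Subgroup.center G) x := fun y hy =>
    mem_centralizerModulo.mpr <| commutator_centralizer_commutator_le_center G <|
      Subgroup.commutator_mem_commutator hxD hy
  have hindex : (commutatorCentralizer G).index =
      (centralizerModulo (Subgroup.center G) x).index := by
    rw [index_commutatorCentralizer h₃ hφ, h.isGeneralizedCaminaPair.index_centralizerModulo
      (h.isGeneralizedCaminaPair.center_le (commutator_ne_bot_of_thirdTerm_ne_bot hne)) hx]
  exact (eq_of_le_of_not_lt hle fun hlt => (Subgroup.index_strictAnti hlt).ne' hindex).symm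

theorem relIndex_thirdTerm_sq_le_index {p : ℕ} [Fact p.Prime] (hG : IsPGroup p G)
    (hlt : thirdTerm G < commutator G) :
    (thirdTerm G).relIndex (commutator G) ^ 2 ≤ (commutator G).index := by
  have hsurj := QuotientGroup.mk'_surjective (thirdTerm G)
  have hne : commutator (G ⧸ thirdTerm G) ≠ ⊥ := by
    rw [← map_commutator_of_surjective hsurj, Ne, Subgroup.map_eq_bot_iff, QuotientGroup.ker_mk']
    exact hlt.not_ge
  have hpair := (h.map hsurj).isGeneralizedCaminaPair
  have hcenter : commutator (G ⧸ thirdTerm G) = Subgroup.center (G ⧸ thirdTerm G) := by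
    refine le_antisymm ?_ (hpair.center_le hne)
    rw [commutator_le_center_iff_thirdTerm_eq_bot, ← map_thirdTerm_of_surjective hsurj,
      QuotientGroup.map_mk'_self]
  rw [hcenter] at hpair
  calc (thirdTerm G).relIndex (commutator G) ^ 2
      = Nat.card (commutator (G ⧸ thirdTerm G)) ^ 2 := by rw [card_commutator_quotient]
    _ ≤ (Subgroup.center (G ⧸ thirdTerm G)).index :=
        card_commutator_sq_le_index_center (hG.to_quotient _) hne hpair
    _ = (commutator G).index := by
        rw [← hcenter, ← map_commutator_of_surjective hsurj,
          Subgroup.index_map_eq _ hsurj (by rw [QuotientGroup.ker_mk']; exact hlt.le)]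

theorem center_eq_thirdTerm_of_injective {p : ℕ} [Fact p.Prime] (hG : IsPGroup p G)
    (h₃ : thirdTerm G ≤ Subgroup.center G) (hne : thirdTerm G ≠ ⊥)
    {φ : thirdTerm G →* ℂˣ} (hφ : Function.Injective φ) :
    Subgroup.center G = thirdTerm G := by
  have hcenter : Subgroup.center G ≤ commutator G :=
    h.isGeneralizedCaminaPair.center_le (commutator_ne_bot_of_thirdTerm_ne_bot hne)
  have hG' := commutator_le_commutatorCentralizer h₃
  have hlt : thirdTerm G < commutator G := thirdTerm_le_commutator.lt_of_ne fun heq =>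
    hne (commutator_le_center_iff_thirdTerm_eq_bot.mp (heq ▸ h₃))
  have hD : (commutator G).relIndex (commutatorCentralizer G) ≤
      (Subgroup.center G).relIndex (commutator G) :=
    h.relIndex_commutator_le hcenter hG' (commutatorCentralizer_ne_top hne) fun x hxD hx =>
      (h.centralizerModulo_center_eq h₃ hne hφ hxD hx).le
  have hsq : (thirdTerm G).relIndex (commutator G) ^ 2 ≤
      (Subgroup.center G).relIndex (commutator G) ^ 2 :=
    calc (thirdTerm G).relIndex (commutator G) ^ 2 ≤ (commutator G).index :=
          h.relIndex_thirdTerm_sq_le_index hG hlt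
      _ = (commutator G).relIndex (commutatorCentralizer G) *
            (Subgroup.center G).relIndex (commutator G) := by
          rw [← index_commutatorCentralizer h₃ hφ, Subgroup.relIndex_mul_index hG']
      _ ≤ (Subgroup.center G).relIndex (commutator G) ^ 2 := by
          rw [sq]
          exact Nat.mul_le_mul_right _ hD
  have hle : (thirdTerm G).relIndex (Subgroup.center G) ≤ 1 := by
    rw [Nat.pow_le_pow_iff_left two_ne_zero,
      ← Subgroup.relIndex_mul_relIndex _ _ _ h₃ hcenter] at hsq
    exact (mul_le_iff_le_one_left (Nat.pos_of_ne_zero Subgroup.index_ne_zero_of_finite)).mp hsq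
  exact le_antisymm (Subgroup.relIndex_eq_one.mp <| hle.antisymm <|
    Nat.one_le_iff_ne_zero.mpr Subgroup.index_ne_zero_of_finite) h₃

end IsCaminaGroup

theorem map_le_center_of_surjective {G' : Type*} [Group G'] {f : G →* G'}
    (hf : Function.Surjective f) {N : Subgroup G} (hN : N ≤ Subgroup.center G) :
    N.map f ≤ Subgroup.center G' := by
  rw [← Subgroup.commutator_top_right_eq_bot_iff_le_center] at hN ⊢
  rw [← Subgroup.map_top_of_surjective f hf, ← Subgroup.map_commutator, hN, Subgroup.map_bot]

theorem exists_normal_notMem_injective_map {W : Subgroup G} [Finite W]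
    (hW : W ≤ Subgroup.center G) {t : G} (ht : t ∈ W) (ht₁ : t ≠ 1) :
    ∃ (K : Subgroup G) (_ : K.Normal), K ≤ W ∧ t ∉ K ∧
      ∃ φ : W.map (QuotientGroup.mk' K) →* ℂˣ, Function.Injective φ := by
  have : IsMulCommutative W := isMulCommutative_of_le_center hW
  obtain ⟨χ, hχ⟩ := CommGroup.exists_apply_ne_one_of_hasEnoughRootsOfUnity W ℂ
    (a := ⟨t, ht⟩) (fun h => ht₁ (congrArg Subtype.val h))
  let K : Subgroup G := χ.ker.map W.subtype
  have hKW : K ≤ W := Subgroup.map_subtype_le _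
  have hK (w : W) : (w : G) ∈ K ↔ χ w = 1 := Subgroup.mem_map_iff_mem W.subtype_injective
  have hKnormal : K.Normal := Subgroup.commutator_top_right_le_iff.mp <|
    (Subgroup.commutator_top_right_eq_bot_iff_le_center.mpr (hKW.trans hW)).trans_le bot_le
  let f : W →* W.map (QuotientGroup.mk' K) := (QuotientGroup.mk' K).subgroupMap W
  have hf : Function.Surjective f := (QuotientGroup.mk' K).subgroupMap_surjective W
  have hker (w : W) : f w = 1 ↔ χ w = 1 := by
    rw [← hK, ← QuotientGroup.eq_one_iff, Subtype.ext_iff]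
    rfl
  refine ⟨K, hKnormal, hKW, fun htK => hχ ((hK ⟨t, ht⟩).mp htK),
    f.liftOfSurjective hf ⟨χ, fun w hw => (hker w).mp hw⟩, ?_⟩
  rw [injective_iff_map_eq_one]
  intro q hq
  obtain ⟨w, rfl⟩ := hf q
  rw [MonoidHom.liftOfRightInverse_comp_apply] at hq
  exact (hker w).mpr hq

theorem exists_quotient_injective_thirdTerm [Finite G] (h₃ : thirdTerm G ≤ Subgroup.center G)
    {t : G} (ht : t ∈ thirdTerm G) (ht₁ : t ≠ 1) :
    ∃ (K : Subgroup G) (_ : K.Normal), K ≤ thirdTerm G ∧ t ∉ K ∧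
      thirdTerm (G ⧸ K) ≤ Subgroup.center (G ⧸ K) ∧ thirdTerm (G ⧸ K) ≠ ⊥ ∧
      ∃ φ : thirdTerm (G ⧸ K) →* ℂˣ, Function.Injective φ := by
  obtain ⟨K, hK, hK₃, htK, hφ⟩ := exists_normal_notMem_injective_map h₃ ht ht₁
  have hsurj := QuotientGroup.mk'_surjective K
  have hmap := map_thirdTerm_of_surjective hsurj
  refine ⟨K, hK, hK₃, htK, hmap ▸ map_le_center_of_surjective hsurj h₃, ?_, hmap ▸ hφ⟩
  rw [← hmap, Ne, Subgroup.map_eq_bot_iff, QuotientGroup.ker_mk']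
  exact fun hle => htK (hle ht)

theorem thirdTerm_le_center_of_nilpotencyClass_eq [Group.IsNilpotent G]
    (hG : Group.nilpotencyClass G = 3) : thirdTerm G ≤ Subgroup.center G :=
  Subgroup.commutator_top_right_eq_bot_iff_le_center.mp <|
    Subgroup.lowerCentralSeries_eq_bot_iff_nilpotencyClass_le.mpr hG.le

theorem thirdTerm_ne_bot_of_nilpotencyClass_eq [Group.IsNilpotent G]
    (hG : Group.nilpotencyClass G = 3) : thirdTerm G ≠ ⊥ := fun hbot => by
  have := Subgroup.lowerCentralSeries_eq_bot_iff_nilpotencyClass_le (n := 2).mp hbot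
  omega

namespace IsCaminaGroup

variable [Finite G] (h : IsCaminaGroup G) {p : ℕ} [Fact p.Prime]

include h

theorem center_eq_thirdTerm (hG : IsPGroup p G) (h₃ : thirdTerm G ≤ Subgroup.center G)
    (hne : thirdTerm G ≠ ⊥) : Subgroup.center G = thirdTerm G := by
  obtain ⟨⟨t, ht⟩, ht₁⟩ := Subgroup.ne_bot_iff_exists_ne_one.mp hne
  obtain ⟨K, _, hK₃, -, hK₃c, hKne, φ, hφ⟩ :=
    exists_quotient_injective_thirdTerm h₃ ht fun h1 => ht₁ (Subtype.ext h1)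
  have hsurj := QuotientGroup.mk'_surjective K
  refine le_antisymm ?_ h₃
  calc Subgroup.center G ≤ (Subgroup.center (G ⧸ K)).comap (QuotientGroup.mk' K) :=
        Subgroup.map_le_iff_le_comap.mp (map_le_center_of_surjective hsurj le_rfl)
    _ = ((thirdTerm G).map (QuotientGroup.mk' K)).comap (QuotientGroup.mk' K) := by
        rw [(h.map hsurj).center_eq_thirdTerm_of_injective (hG.to_quotient K) hK₃c hKne hφ,
          map_thirdTerm_of_surjective hsurj]
    _ = thirdTerm G := Subgroup.comap_map_eq_self (by rwa [QuotientGroup.ker_mk'])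

theorem centralizerModulo_thirdTerm_le (h₃ : thirdTerm G ≤ Subgroup.center G) {x : G}
    (hxC : x ∈ commutatorCentralizer G) (hx : x ∉ commutator G) :
    centralizerModulo (thirdTerm G) x ≤ commutatorCentralizer G := by
  intro g hg
  refine Subgroup.mem_centralizer_iff_commutator_eq_one.mpr fun z hz => ?_
  by_contra ht₁
  obtain ⟨K, _, hK₃, htK, hK₃c, hKne, φ, hφ⟩ := exists_quotient_injective_thirdTerm h₃
    (Subgroup.commutator_mem_commutator hz (Subgroup.mem_top g)) ht₁
  have hsurj := QuotientGroup.mk'_surjective K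
  have hmap := map_commutator_of_surjective hsurj
  have hxK : (x : G ⧸ K) ∉ commutator (G ⧸ K) := by
    rwa [← hmap, ← QuotientGroup.mk'_apply, ← Subgroup.mem_comap, Subgroup.comap_map_eq_self
      (by rw [QuotientGroup.ker_mk']; exact hK₃.trans thirdTerm_le_commutator)]
  have hxCK : (x : G ⧸ K) ∈ commutatorCentralizer (G ⧸ K) := by
    rw [commutatorCentralizer, ← hmap]
    exact Subgroup.map_centralizer_le_centralizer_image _ _ (Subgroup.mem_map_of_mem _ hxC)
  have hgK : (g : G ⧸ K) ∈ centralizerModulo (Subgroup.center (G ⧸ K)) (x : G ⧸ K) :=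
    mem_centralizerModulo.mpr <| map_le_center_of_surjective hsurj h₃ <|
      Subgroup.mem_map_of_mem (QuotientGroup.mk' K) (mem_centralizerModulo.mp hg)
  rw [(h.map hsurj).centralizerModulo_center_eq hK₃c hKne hφ hxCK hxK] at hgK
  refine htK ((QuotientGroup.eq_one_iff _).mp ?_)
  exact Subgroup.mem_centralizer_iff_commutator_eq_one.mp hgK (z : G ⧸ K)
    (hmap ▸ Subgroup.mem_map_of_mem (QuotientGroup.mk' K) hz)

theorem relIndex_commutator_commutatorCentralizer_le (h₃ : thirdTerm G ≤ Subgroup.center G)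
    (hne : thirdTerm G ≠ ⊥) :
    (commutator G).relIndex (commutatorCentralizer G) ≤ (thirdTerm G).relIndex (commutator G) :=
  h.relIndex_commutator_le thirdTerm_le_commutator (commutator_le_commutatorCentralizer h₃)
    (commutatorCentralizer_ne_top hne) fun _ => h.centralizerModulo_thirdTerm_le h₃

variable (hG : IsPGroup p G) (h₃ : thirdTerm G ≤ Subgroup.center G) (hne : thirdTerm G ≠ ⊥)
  (hlt : commutator G < commutatorCentralizer G)

include hG h₃ hne hlt

theorem map_commutator_commutatorCentralizer :
    (commutator (commutatorCentralizer G)).map (commutatorCentralizer G).subtype =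
      thirdTerm G := by
  rw [Subgroup.map_subtype_commutator]
  refine le_antisymm ?_ fun z hz => ?_
  · rw [← h.center_eq_thirdTerm hG h₃ hne]
    exact commutator_centralizer_commutator_le_center G
  · obtain ⟨x, hxC, hx⟩ := SetLike.exists_of_lt hlt
    obtain ⟨y, rfl⟩ := isGeneralizedCaminaPair_iff.mp h.isGeneralizedCaminaPair x hx z
      (thirdTerm_le_commutator hz)
    exact Subgroup.commutator_mem_commutator hxC
      (h.centralizerModulo_thirdTerm_le h₃ hxC hx (mem_centralizerModulo.mpr hz))

theorem commutator_commutatorCentralizer_ne_bot : commutator (commutatorCentralizer G) ≠ ⊥ :=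
  fun hbot => hne <| by
    rw [← h.map_commutator_commutatorCentralizer hG h₃ hne hlt, hbot, Subgroup.map_bot]

theorem isGeneralizedCaminaPair_commutatorCentralizer :
    IsGeneralizedCaminaPair ((commutator G).subgroupOf (commutatorCentralizer G)) := by
  refine isGeneralizedCaminaPair_iff.mpr fun x hx z hz => ?_
  have hz₃ : (z : G) ∈ thirdTerm G :=
    h.map_commutator_commutatorCentralizer hG h₃ hne hlt ▸ Subgroup.mem_map_of_mem _ hz
  obtain ⟨y, hy⟩ := isGeneralizedCaminaPair_iff.mp h.isGeneralizedCaminaPair x hx z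
    (thirdTerm_le_commutator hz₃)
  have hyC := h.centralizerModulo_thirdTerm_le h₃ x.2 hx (mem_centralizerModulo.mpr (hy ▸ hz₃))
  exact ⟨⟨y, hyC⟩, Subtype.ext hy⟩

theorem center_commutatorCentralizer :
    Subgroup.center (commutatorCentralizer G) =
      (commutator G).subgroupOf (commutatorCentralizer G) :=
  le_antisymm
    ((h.isGeneralizedCaminaPair_commutatorCentralizer hG h₃ hne hlt).center_le
      (h.commutator_commutatorCentralizer_ne_bot hG h₃ hne hlt))
    fun z hz => Subgroup.mem_center_iff.mpr fun y => Subtype.ext (y.2 z hz).symm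

theorem isGeneralizedCaminaPair_center_commutatorCentralizer :
    IsGeneralizedCaminaPair (Subgroup.center (commutatorCentralizer G)) :=
  h.center_commutatorCentralizer hG h₃ hne hlt ▸
    h.isGeneralizedCaminaPair_commutatorCentralizer hG h₃ hne hlt

theorem card_thirdTerm_sq_le_relIndex :
    Nat.card (thirdTerm G) ^ 2 ≤ (thirdTerm G).relIndex (commutator G) :=
  calc Nat.card (thirdTerm G) ^ 2 = Nat.card (commutator (commutatorCentralizer G)) ^ 2 := by
        rw [← h.map_commutator_commutatorCentralizer hG h₃ hne hlt,
          Subgroup.card_map_of_injective (Subgroup.subtype_injective _)]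
    _ ≤ (Subgroup.center (commutatorCentralizer G)).index :=
        card_commutator_sq_le_index_center (hG.to_subgroup _)
          (h.commutator_commutatorCentralizer_ne_bot hG h₃ hne hlt)
          (h.isGeneralizedCaminaPair_center_commutatorCentralizer hG h₃ hne hlt)
    _ = (commutator G).relIndex (commutatorCentralizer G) := by
        rw [h.center_commutatorCentralizer hG h₃ hne hlt, Subgroup.relIndex]
    _ ≤ (thirdTerm G).relIndex (commutator G) :=
        h.relIndex_commutator_commutatorCentralizer_le h₃ hne

end IsCaminaGroup

end CaminaGroups

theorem theorem3p9 {G : Type*} [Group G] [Finite G] [Group.IsNilpotent G]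
    (p : ℕ) (hp : p.Prime) (hpG : IsPGroup p G)
    (hCamina : IsCaminaGroup G)
    (hclass : Group.nilpotencyClass G = 3)
    (C : Subgroup G) (hC : C = Subgroup.centralizer (commutator G : Set G))
    (hlt : commutator G < C) :
    ((commutator C).map C.subtype = thirdTerm G ∧
      (Subgroup.center C).map C.subtype = commutator G) ∧
    IsVZGroup C ∧
    (Nat.card (thirdTerm G) : ℝ) ≤
      (((thirdTerm G).relIndex (commutator G) : ℕ) : ℝ) ^ ((1 : ℝ) / 2) := by
  subst hC
  have := Fact.mk hp
  have h₃ := thirdTerm_le_center_of_nilpotencyClass_eq hclass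
  have hne := thirdTerm_ne_bot_of_nilpotencyClass_eq hclass
  refine ⟨⟨hCamina.map_commutator_commutatorCentralizer hpG h₃ hne hlt, ?_⟩,
    isVZGroup_of_isGeneralizedCaminaPair_center
      (hCamina.isGeneralizedCaminaPair_center_commutatorCentralizer hpG h₃ hne hlt), ?_⟩
  · rw [hCamina.center_commutatorCentralizer hpG h₃ hne hlt, Subgroup.subgroupOf_map_subtype]
    exact inf_eq_left.mpr hlt.le
  · rw [← Real.sqrt_eq_rpow]
    exact Real.le_sqrt_of_sq_le
      (by exact_mod_cast hCamina.card_thirdTerm_sq_le_relIndex hpG h₃ hne hlt)
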